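/- Let $\mathbb G$ be a graded Lie group of homogeneous dimension $Q$, with dilations $D_r$, and let $\mathcal R$ be a positive Rockland operator of homogeneous degree $\nu>0$ on $\mathbb G$, that is, a left-invariant, homogeneous, hypoelliptic differential operator with $(\mathcal Rf,f)_{L^2}\ge 0$ for all $f\in C_c^\infty(\mathbb G)$; its self-adjoint extension on $L^2(\mathbb G)$ is denoted by $\mathcal R$ as well. Let $s>0$, $T>0$, let $H^{s\nu/2}(\mathbb G)=\mathrm{Dom}(\mathcal R^{s/2})$ with norm $\|f\|_{H^{s\nu/2}}=\|\mathcal R^{s/2}f\|_{L^2}+\|f\|_{L^2}$, and let $\mathcal E'(\mathbb G)$ be the space of compactly supported distributions. Suppose that $$u_0\in H^{s\nu/2}(\mathbb G)\cup\mathcal E'(\mathbb G),\qquad u_1\in L^2(\mathbb G)\cup\mathcal E'(\mathbb G).$$ Then the very weak solution of the Cauchy problem $u_{tt}+\mathcal R^su+mu=0$ on $[0,T]\times\mathbb G$, $u(0)=u_0$, $u_t(0)=u_1$, is $(L^\infty,L^\infty)$-unique in the following sense. A net $(f_\epsilon)_{\epsilon\in(0,1]}$ in a normed space $X$ is $X$-moderate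 if $\|f_\epsilon\|_X\le C\epsilon^{-N}$ for some $N\in\mathbb N$, $C$ and all $\epsilon\in(0,1]$; it is $X$-negligible if for every $N\in\mathbb N$ there is $C_N$ with $\|f_\epsilon\|_X\le C_N\epsilon^N$ for all $\epsilon\in(0,1]$. A regularisation of a datum $v$ is either the constant net $v_\epsilon=v$ (if $v$ belongs to $H^{s\nu/2}$ in the case of $u_0$, to $L^2$ in the case of $u_1$) or a net $v_\epsilon=v*\psi_\epsilon$, where $\psi\in C_c^\infty(\mathbb G)$, $\int\psi\,dx=1$ and $\psi_\epsilon(x)=\epsilon^{-Q}\psi(D_{\epsilon^{-1}}x)$. Let $(m_\epsilon)$, $(\tilde m_\epsilon)$ be $L^\infty(\mathbb G)$-moderate nets of functions with $m_\epsilon\ge0$, $\tilde m_\epsilon\ge 0$ such that $(m_\epsilon-\tilde m_\epsilon)$ is $L^\infty(\mathbb G)$-negligible. Let $(u_{0,\epsilon},u_{1,\epsilon})$ and $(\tilde u_{0,\epsilon},\tilde u_{1,\epsilon})$ be $H^{s\nu/2}\times L^2$-moderate regularisations of $(u_0,u_1)$ that coincide or, more generally, whose difference is $H^{s\nu/2}\times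 L^2$-negligible. For each $\epsilon\in(0,1]$ let $u_\epsilon,\tilde u_\epsilon\in C([0,T];H^{s\nu/2}(\mathbb G))\cap C^1([0,T];L^2(\mathbb G))$ be solutions of $$\partial_t^2u_\epsilon+\mathcal R^su_\epsilon+m_\epsilon u_\epsilon=0,\quad u_\epsilon(0)=u_{0,\epsilon},\ \partial_tu_\epsilon(0)=u_{1,\epsilon},$$ $$\partial_t^2\tilde u_\epsilon+\mathcal R^s\tilde u_\epsilon+\tilde m_\epsilon\tilde u_\epsilon=0,\quad \tilde u_\epsilon(0)=\tilde u_{0,\epsilon},\ \partial_t\tilde u_\epsilon(0)=\tilde u_{1,\epsilon},$$ where the equations hold in the dual of $H^{s\nu/2}(\mathbb G)$ for every $t\in[0,T]$. Then for every $N\in\mathbb N$ there is a constant $C_N$ such that $$\|u_\epsilon(t,\cdot)-\tilde u_\epsilon(t,\cdot)\|_{L^2(\mathbb G)}\le C_N\,\epsilon^N\qquad\text{for all }\epsilon\in(0,1]\text{ and all }t\in[0,T].$$ -/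

import Mathlib

open MeasureTheory Set Filter Topology TopologicalSpace
open scoped Distributions ContDiff ComplexConjugate ENNReal

noncomputable section

namespace GradedKG

/-- The underlying space `ℝⁿ` of a graded group of topological dimension `n`, in coordinates. -/
abbrev Pt (n : ℕ) := EuclideanSpace ℝ (Fin n)

/-- The anisotropic dilation `D_r (x₁, …, xₙ) = (r ^ v₁ x₁, …, r ^ vₙ xₙ)`. -/
def dilation {n : ℕ} (v : Fin n → ℕ) (r : ℝ) (x : Pt n) : Pt n :=
  WithLp.toLp 2 (fun i => r ^ v i * x i)

/-- A graded Lie group, realised on `ℝⁿ` (as the exponential map allows): a smooth group law with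
identity `0` for which the dilations `D_r` with positive integer weights `vᵢ` are automorphisms.
The Lie algebra is then graded by `𝔤_k = span {X_i | v_i = k}`. Lebesgue measure is the
(bi-invariant) Haar measure. -/
structure GradedGroup (n : ℕ) where
  /-- the group law -/
  mul : Pt n → Pt n → Pt n
  /-- the inverse -/
  inv : Pt n → Pt n
  /-- the weights of the dilations -/
  weight : Fin n → ℕ
  weight_pos : ∀ i, 0 < weight i
  mul_assoc : ∀ x y z, mul (mul x y) z = mul x (mul y z)
  zero_mul : ∀ x, mul 0 x = x
  mul_zero : ∀ x, mul x 0 = x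
  inv_mul_cancel : ∀ x, mul (inv x) x = 0
  contDiff_mul : ContDiff ℝ ∞ (fun p : Pt n × Pt n => mul p.1 p.2)
  contDiff_inv : ContDiff ℝ ∞ inv
  dilation_mul : ∀ r : ℝ, 0 < r → ∀ x y,
    dilation weight r (mul x y) = mul (dilation weight r x) (dilation weight r y)

/-- Smooth compactly supported complex functions on all of `ℝⁿ`. -/
abbrev Test (n : ℕ) := 𝓓((⊤ : Opens (Pt n)), ℂ)

/-- Complex distributions on an open set: continuous `ℂ`-linear functionals on test functions. -/
abbrev Distr {n : ℕ} (Ω : Opens (Pt n)) := 𝓓(Ω, ℂ) →L[ℂ] ℂ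

/-- The Hilbert space `L²(G)`. -/
abbrev L2 (n : ℕ) := Lp ℂ 2 (volume : Measure (Pt n))

namespace GradedGroup

variable {n : ℕ} (G : GradedGroup n)

/-- The homogeneous dimension `Q`. -/
def homDim : ℕ := ∑ i, G.weight i

/-- The left-invariant vector field `X_j f (x) = d/dt f (x · exp (t X_j))` at `t = 0`, where
`X_j` is the `j`-th basis vector of the Lie algebra `T₀ G = ℝⁿ`. -/
def leftField (j : Fin n) (f : Pt n → ℂ) (x : Pt n) : ℂ :=
  fderiv ℝ (fun y => f (G.mul x y)) 0 (EuclideanSpace.single j 1)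

/-- The composition `X_{i₁} X_{i₂} ⋯ X_{i_k}` for a word `[i₁, …, i_k]`. -/
def wordField (w : List (Fin n)) (f : Pt n → ℂ) : Pt n → ℂ :=
  w.foldr G.leftField f

/-- The left-invariant differential operator `∑ a_w X_w` (every left-invariant differential
operator is of this form). -/
def diffOp (c : List (Fin n) →₀ ℂ) (f : Pt n → ℂ) (x : Pt n) : ℂ :=
  c.sum fun w a => a * G.wordField w f x

/-- The formal transpose `∑ a_w (-1)^{|w|} X_{reverse w}`: the vector fields `X_j` are formally
skew-symmetric for the bilinear pairing `∫ f g`. -/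
def diffOpTranspose (c : List (Fin n) →₀ ℂ) (f : Pt n → ℂ) (x : Pt n) : ℂ :=
  c.sum fun w a => a * (-1) ^ w.length * G.wordField w.reverse f x

theorem contDiff_leftField (j : Fin n) {f : Pt n → ℂ} (hf : ContDiff ℝ ∞ f) :
    ContDiff ℝ ∞ (G.leftField j f) := by
  have h : ContDiff ℝ ∞ (Function.uncurry fun x y => f (G.mul x y)) :=
    hf.comp G.contDiff_mul
  exact (ContDiff.fderiv h (contDiff_const (c := (0 : Pt n))) (by simp)).clm_apply contDiff_const

theorem tsupport_leftField_subset (j : Fin n) (f : Pt n → ℂ) :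
    tsupport (G.leftField j f) ⊆ tsupport f := by
  intro x hx
  by_contra hxf
  have hU : (tsupport f)ᶜ ∈ 𝓝 x := (isClosed_tsupport f).isOpen_compl.mem_nhds hxf
  refine (mem_closure_iff_nhds.1 hx _ hU).elim fun z hz => hz.2 ?_
  have hc : Continuous fun y => G.mul z y :=
    G.contDiff_mul.continuous.comp (Continuous.prodMk_right z)
  have h0 : (fun y => f (G.mul z y)) =ᶠ[𝓝 0] fun _ => 0 := by
    have : (fun y => G.mul z y) ⁻¹' (tsupport f)ᶜ ∈ 𝓝 (0 : Pt n) := by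
      refine hc.continuousAt.preimage_mem_nhds ?_
      rw [G.mul_zero]
      exact (isClosed_tsupport f).isOpen_compl.mem_nhds hz.1
    filter_upwards [this] with y hy
    exact image_eq_zero_of_notMem_tsupport hy
  simp [leftField, h0.fderiv_eq]

theorem contDiff_wordField (w : List (Fin n)) {f : Pt n → ℂ} (hf : ContDiff ℝ ∞ f) :
    ContDiff ℝ ∞ (G.wordField w f) := by
  induction w with
  | nil => exact hf
  | cons j w ih => exact G.contDiff_leftField j ih

theorem tsupport_wordField_subset (w : List (Fin n)) (f : Pt n → ℂ) :
    tsupport (G.wordField w f) ⊆ tsupport f := by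
  induction w with
  | nil => exact subset_rfl
  | cons j w ih => exact (G.tsupport_leftField_subset j _).trans ih

theorem contDiff_diffOpTranspose (c : List (Fin n) →₀ ℂ) {f : Pt n → ℂ} (hf : ContDiff ℝ ∞ f) :
    ContDiff ℝ ∞ (G.diffOpTranspose c f) := by
  unfold diffOpTranspose Finsupp.sum
  exact ContDiff.sum fun w _ => contDiff_const.mul (G.contDiff_wordField _ hf)

theorem tsupport_diffOpTranspose_subset (c : List (Fin n) →₀ ℂ) (f : Pt n → ℂ) :
    tsupport (G.diffOpTranspose c f) ⊆ tsupport f := by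
  refine closure_minimal (fun x hx => ?_) (isClosed_tsupport f)
  by_contra hxf
  refine hx (Finset.sum_eq_zero fun w _ => ?_)
  have : x ∉ tsupport (G.wordField w.reverse f) :=
    fun h => hxf (G.tsupport_wordField_subset _ _ h)
  simp [image_eq_zero_of_notMem_tsupport this]

/-- The formal transpose acting on test functions on an open set `Ω`. -/
def transposeTest (c : List (Fin n) →₀ ℂ) {Ω : Opens (Pt n)} (φ : 𝓓(Ω, ℂ)) : 𝓓(Ω, ℂ) where
  toFun := G.diffOpTranspose c φ
  contDiff' := G.contDiff_diffOpTranspose c φ.contDiff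
  hasCompactSupport' :=
    φ.hasCompactSupport.of_isClosed_subset (isClosed_tsupport _)
      (G.tsupport_diffOpTranspose_subset c φ)
  tsupport_subset' := (G.tsupport_diffOpTranspose_subset c φ).trans φ.tsupport_subset

/-- Hypoellipticity of `P = ∑ a_w X_w`: a distribution `u` on an open set `Ω` for which `P u` is a
smooth function on `Ω` is itself a smooth function on `Ω`. Here `⟨P u, φ⟩ = ⟨u, Pᵗ φ⟩`. -/
def IsHypoelliptic (c : List (Fin n) →₀ ℂ) : Prop :=
  ∀ (Ω : Opens (Pt n)) (u : Distr Ω) (g : Pt n → ℂ), ContDiffOn ℝ ∞ g Ω →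
    (∀ φ : 𝓓(Ω, ℂ), u (G.transposeTest c φ) = ∫ x, g x * φ x) →
    ∃ h : Pt n → ℂ, ContDiffOn ℝ ∞ h Ω ∧ ∀ φ : 𝓓(Ω, ℂ), u φ = ∫ x, h x * φ x

/-- `P` is homogeneous of degree `ν`: `P (f ∘ D_r) = r ^ ν (P f) ∘ D_r` for smooth `f`. -/
def IsHomogeneousOp (c : List (Fin n) →₀ ℂ) (ν : ℝ) : Prop :=
  ∀ r : ℝ, 0 < r → ∀ f : Pt n → ℂ, ContDiff ℝ ∞ f → ∀ x,
    G.diffOp c (fun y => f (dilation G.weight r y)) x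
      = ((r ^ ν : ℝ) : ℂ) * G.diffOp c f (dilation G.weight r x)

/-- The quadratic form `(P φ, φ)` of `L²(G)` on test functions. -/
def quadForm (c : List (Fin n) →₀ ℂ) (φ : Test n) : ℂ :=
  ∫ x, G.diffOp c φ x * conj (φ x)

/-- A positive Rockland operator of homogeneous degree `ν > 0`: a left-invariant, homogeneous,
hypoelliptic differential operator `∑ a_w X_w` with `(R φ, φ) ≥ 0` on test functions. -/
structure PositiveRockland (ν : ℝ) where
  /-- the coefficients `a_w` -/
  coeff : List (Fin n) →₀ ℂ
  degree_pos : 0 < ν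
  homogeneous : G.IsHomogeneousOp coeff ν
  hypoelliptic : G.IsHypoelliptic coeff
  nonneg : ∀ φ : Test n, 0 ≤ (G.quadForm coeff φ).re ∧ (G.quadForm coeff φ).im = 0

theorem mul_inv_mul (x y : Pt n) : G.mul y (G.mul (G.inv y) x) = x := by
  have h : G.mul y (G.inv y) = 0 := by
    calc G.mul y (G.inv y)
        = G.mul (G.mul (G.inv (G.inv y)) (G.inv y)) (G.mul y (G.inv y)) := by
          rw [G.inv_mul_cancel, G.zero_mul]
      _ = G.mul (G.inv (G.inv y)) (G.mul (G.mul (G.inv y) y) (G.inv y)) := by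
          simp only [G.mul_assoc]
      _ = 0 := by rw [G.inv_mul_cancel, G.zero_mul, G.inv_mul_cancel]
  rw [← G.mul_assoc, h, G.zero_mul]

theorem contDiff_dilation (v : Fin n → ℕ) (r : ℝ) : ContDiff ℝ ∞ (dilation v r) := by
  unfold dilation
  fun_prop

theorem dilation_dilation_inv (v : Fin n → ℕ) {r : ℝ} (hr : 0 < r) (x : Pt n) :
    dilation v r (dilation v r⁻¹ x) = x := by
  ext i
  have : r ^ v i ≠ 0 := pow_ne_zero _ hr.ne'
  simp [dilation]
  field_simp

/-- The test function `y ↦ ψ_ε (y⁻¹ x)`, where `ψ_ε (z) = ε^{-Q} ψ (D_{1/ε} z)`. -/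
def mollifierAt (ψ : Test n) {ε : ℝ} (hε : 0 < ε) (x : Pt n) : Test n where
  toFun y := (((ε ^ G.homDim)⁻¹ : ℝ) : ℂ) *
    ψ (dilation G.weight ε⁻¹ (G.mul (G.inv y) x))
  contDiff' := by
    refine contDiff_const.mul (ψ.contDiff.comp ((contDiff_dilation _ _).comp ?_))
    exact G.contDiff_mul.comp (G.contDiff_inv.prodMk contDiff_const)
  hasCompactSupport' := by
    have hc : Continuous fun z => G.mul x (G.inv (dilation G.weight ε z)) :=
      G.contDiff_mul.continuous.comp (continuous_const.prodMk
        (G.contDiff_inv.continuous.comp (contDiff_dilation G.weight ε).continuous))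
    refine HasCompactSupport.intro (ψ.hasCompactSupport.isCompact.image hc) fun y hy => ?_
    suffices h : dilation G.weight ε⁻¹ (G.mul (G.inv y) x) ∉ tsupport ψ by
      rw [image_eq_zero_of_notMem_tsupport h, MulZeroClass.mul_zero]
    intro hmem
    refine hy ⟨_, hmem, ?_⟩
    simp only [dilation_dilation_inv G.weight hε]
    set z := G.mul (G.inv y) x with hz
    have h1 : x = G.mul y z := (G.mul_inv_mul x y).symm
    have h2 : G.mul z (G.inv z) = 0 := by
      simpa [G.mul_zero] using G.mul_inv_mul 0 z
    rw [h1, G.mul_assoc, h2, G.mul_zero]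
  tsupport_subset' := by simp

/-- The convolution `(v * ψ_ε)(x) = ⟨v, y ↦ ψ_ε (y⁻¹ x)⟩` of a distribution with `ψ_ε`. -/
def mollify (v : Distr (⊤ : Opens (Pt n))) (ψ : Test n) {ε : ℝ} (hε : 0 < ε) (x : Pt n) : ℂ :=
  v (G.mollifierAt ψ hε x)

end GradedGroup

/-- The distribution `v` is the function `f ∈ L²(G)`. -/
def IsFunction {n : ℕ} (v : Distr (⊤ : Opens (Pt n))) (f : L2 n) : Prop :=
  ∀ φ : Test n, v φ = ∫ x, f x * φ x

/-- `v ∈ 𝓔'(G)`: the distribution `v` has compact support. -/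
def HasCompactSupp {n : ℕ} (v : Distr (⊤ : Opens (Pt n))) : Prop :=
  ∃ K : Set (Pt n), IsCompact K ∧ ∀ φ : Test n, Disjoint (tsupport φ) K → v φ = 0

/-- The graph of the fractional power `A ^ a`, `a > 0`, in the functional calculus of a non-negative
self-adjoint operator `A` given by its graph. With `J = (1 + A)⁻¹`, so that `A = (1 - J) J⁻¹` and
`0 ≤ J ≤ 1` is injective, one has `A ^ a f = g` if and only if `(1 - J) ^ a f = J ^ a g`, where
`(1 - J) ^ a` and `J ^ a` are given by the continuous functional calculus of bounded operators. -/
def IsFracPow {H : Type*} [NormedAddCommGroup H] [InnerProductSpace ℂ H] [CompleteSpace H]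
    (A : H → H → Prop) (a : ℝ) (f g : H) : Prop :=
  ∃ J : H →L[ℂ] H, (∀ h, A (J h) (h - J h)) ∧
    cfc (fun x : ℝ => (1 - x) ^ a) J f = cfc (fun x : ℝ => x ^ a) J g

namespace GradedGroup.PositiveRockland

variable {n : ℕ} {G : GradedGroup n} {ν : ℝ} (R : G.PositiveRockland ν)

/-- The graph of the self-adjoint operator `R₂` on `L²(G)` given by `R` on test functions: `R₂ f = g`
if `R f = g` weakly and `f` lies in the closure of the test functions for the form norm. (`R` is
essentially self-adjoint on the test functions, so that this, the Friedrichs extension, is its only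
self-adjoint extension, and the second condition follows from the first.) -/
def IsOp (f g : L2 n) : Prop :=
  (∀ φ : Test n, ∫ x, f x * conj (G.diffOp R.coeff φ x) = ∫ x, g x * conj (φ x)) ∧
  ∃ φ : ℕ → Test n,
    Tendsto (fun k => eLpNorm (fun x => φ k x - f x) 2 volume) atTop (𝓝 0) ∧
    ∀ δ : ℝ, 0 < δ → ∃ K, ∀ j ≥ K, ∀ k ≥ K, (G.quadForm R.coeff (φ j - φ k)).re < δ

/-- The graph of the fractional power `R₂ ^ a`, `a > 0`, of the self-adjoint operator `R₂ ≥ 0`. -/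
def IsPow (a : ℝ) (f g : L2 n) : Prop :=
  IsFracPow R.IsOp a f g

/-- `f ∈ H^σ(G)` with `‖f‖_{H^σ} = ‖R^{σ/ν} f‖ + ‖f‖ ≤ C`. -/
def SobolevNormLE (σ : ℝ) (f : L2 n) (C : ℝ) : Prop :=
  ∃ g : L2 n, R.IsPow (σ / ν) f g ∧ ‖g‖ + ‖f‖ ≤ C

/-- `f ∈ H^σ(G)`. -/
def MemSobolev (σ : ℝ) (f : L2 n) : Prop :=
  ∃ g : L2 n, R.IsPow (σ / ν) f g

/-- `u` belongs to `C([0,T]; H^{sν/2}) ∩ C¹([0,T]; L²)` and solves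
`u_tt + R^s u + m u = 0`, `u(0) = f₀`, `u_t(0) = f₁`. The equation is understood in the dual of
`H^{sν/2}`: it is tested against all `w ∈ H^{sν/2}`, with
`⟨R^s u, w⟩ = ⟨R^{s/2} u, R^{s/2} w⟩`. Note `(sν/2)/ν = s/2`. -/
def IsSolution (s T : ℝ) (m : Pt n → ℝ) (f₀ f₁ : L2 n) (u : ℝ → L2 n) : Prop :=
  ∃ u' Au : ℝ → L2 n,
    ContinuousOn u (Icc 0 T) ∧
    (∀ t ∈ Icc 0 T, R.IsPow (s * ν / 2 / ν) (u t) (Au t)) ∧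
    ContinuousOn Au (Icc 0 T) ∧
    (∀ t ∈ Icc 0 T, HasDerivWithinAt u (u' t) (Icc 0 T) t) ∧
    ContinuousOn u' (Icc 0 T) ∧
    u 0 = f₀ ∧ u' 0 = f₁ ∧
    ∀ w Aw : L2 n, R.IsPow (s * ν / 2 / ν) w Aw → ∀ t ∈ Icc 0 T,
      HasDerivWithinAt (fun τ => inner ℂ w (u' τ))
        (-(inner ℂ Aw (Au t) + ∫ x, conj (w x) * ((m x : ℂ) * u t x))) (Icc 0 T) t

/-- A net in `H^σ(G)` is moderate. -/
def SobolevModerate (σ : ℝ) (f : ℝ → L2 n) : Prop :=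
  ∃ N : ℕ, ∃ C : ℝ, ∀ ε ∈ Ioc (0 : ℝ) 1, R.SobolevNormLE σ (f ε) (C * (ε ^ N)⁻¹)

/-- A net in `H^σ(G)` is negligible. -/
def SobolevNegligible (σ : ℝ) (f : ℝ → L2 n) : Prop :=
  ∀ N : ℕ, ∃ C : ℝ, ∀ ε ∈ Ioc (0 : ℝ) 1, R.SobolevNormLE σ (f ε) (C * ε ^ N)

end GradedGroup.PositiveRockland

/-- A net in `L²(G)` is moderate. -/
def L2Moderate {n : ℕ} (f : ℝ → L2 n) : Prop :=
  ∃ N : ℕ, ∃ C : ℝ, ∀ ε ∈ Ioc (0 : ℝ) 1, ‖f ε‖ ≤ C * (ε ^ N)⁻¹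

/-- A net in `L²(G)` is negligible. -/
def L2Negligible {n : ℕ} (f : ℝ → L2 n) : Prop :=
  ∀ N : ℕ, ∃ C : ℝ, ∀ ε ∈ Ioc (0 : ℝ) 1, ‖f ε‖ ≤ C * ε ^ N

/-- A net of functions in `L^∞(G)` is moderate. -/
def LInftyModerate {n : ℕ} (m : ℝ → Pt n → ℝ) : Prop :=
  ∃ N : ℕ, ∃ C : ℝ, ∀ ε ∈ Ioc (0 : ℝ) 1,
    MemLp (m ε) ∞ volume ∧ (eLpNorm (m ε) ∞ volume).toReal ≤ C * (ε ^ N)⁻¹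

/-- A net of functions in `L^∞(G)` is negligible. -/
def LInftyNegligible {n : ℕ} (m : ℝ → Pt n → ℝ) : Prop :=
  ∀ N : ℕ, ∃ C : ℝ, ∀ ε ∈ Ioc (0 : ℝ) 1,
    MemLp (m ε) ∞ volume ∧ (eLpNorm (m ε) ∞ volume).toReal ≤ C * ε ^ N

namespace GradedGroup

variable {n : ℕ} (G : GradedGroup n)

/-- `(f_ε)` is a regularising net of the datum `v` for the space `Z ⊆ L²(G)`: either the trivial
one, `f_ε = v`, when `v ∈ Z`, or `f_ε = v * ψ_ε` for a Friedrichs mollifier `ψ`. -/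
def IsRegularisation (Z : L2 n → Prop) (v : Distr (⊤ : Opens (Pt n))) (f : ℝ → L2 n) : Prop :=
  (∃ h : L2 n, Z h ∧ IsFunction v h ∧ ∀ ε ∈ Ioc (0 : ℝ) 1, f ε = h) ∨
  ∃ ψ : Test n, ∫ x, ψ x = 1 ∧
    ∀ (ε : ℝ) (hε : ε ∈ Ioc (0 : ℝ) 1), f ε =ᵐ[volume] G.mollify v ψ hε.1

end GradedGroup

/-- The very weak solution of the Cauchy problem
`u_tt + R^s u + m u = 0`, `u(0) = u₀`, `u_t(0) = u₁` is `(L^∞, L^∞)`-unique. The two families of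
data are moderate regularisations of `(u₀, u₁)` that are equal up to negligible nets. -/
def IsLInftyUnique {n : ℕ} {G : GradedGroup n} {ν : ℝ} (R : G.PositiveRockland ν) (s T : ℝ)
    (u₀ u₁ : Distr (⊤ : Opens (Pt n))) : Prop :=
  ∀ m m' : ℝ → Pt n → ℝ,
    (∀ ε ∈ Ioc (0 : ℝ) 1, 0 ≤ᵐ[volume] m ε) →
    (∀ ε ∈ Ioc (0 : ℝ) 1, 0 ≤ᵐ[volume] m' ε) →
    LInftyModerate m → LInftyModerate m' →
    LInftyNegligible (fun ε x => m ε x - m' ε x) →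
  ∀ f₀ f₁ f₀' f₁' : ℝ → L2 n,
    G.IsRegularisation (R.MemSobolev (s * ν / 2)) u₀ f₀ →
    G.IsRegularisation (R.MemSobolev (s * ν / 2)) u₀ f₀' →
    G.IsRegularisation (fun _ => True) u₁ f₁ →
    G.IsRegularisation (fun _ => True) u₁ f₁' →
    R.SobolevModerate (s * ν / 2) f₀ → R.SobolevModerate (s * ν / 2) f₀' →
    L2Moderate f₁ → L2Moderate f₁' →
    R.SobolevNegligible (s * ν / 2) (fun ε => f₀ ε - f₀' ε) →
    L2Negligible (fun ε => f₁ ε - f₁' ε) →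
  ∀ u u' : ℝ → ℝ → L2 n,
    (∀ ε ∈ Ioc (0 : ℝ) 1, R.IsSolution s T (m ε) (f₀ ε) (f₁ ε) (u ε)) →
    (∀ ε ∈ Ioc (0 : ℝ) 1, R.IsSolution s T (m' ε) (f₀' ε) (f₁' ε) (u' ε)) →
  ∀ N : ℕ, ∃ C : ℝ, ∀ ε ∈ Ioc (0 : ℝ) 1, ∀ t ∈ Icc 0 T, ‖u ε t - u' ε t‖ ≤ C * ε ^ N

end GradedKG

end

/-! The difference `z = u - ũ` solves `z'' + R^s z + m z = -(m - m̃) ũ` with negligible data. An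
`L²` bound for `z` whose constants do not depend on `m ≥ 0` therefore suffices: `ũ` grows at most
like a power of `1/ε`, and `m - m̃` decays faster than every power of `ε`.

Testing with `z'`, as for the usual energy, is not allowed, since `z'` lies only in `L²` while the
equation holds in the dual of `H^{sν/2}`. It is tested instead with `v t = ∫_t^σ z`, which lies in
`H^{sν/2}`, satisfies `v' = -z` and vanishes at `σ`. The terms in `R^s` and `m` become exact
derivatives of squares with a favourable sign. With `σ` a maximum point of `‖z‖`, this is
`norm_le_of_weak_wave_equation`.

Subtracting and integrating the relation `R^{s/2} f = g` requires that all its instances come from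
one resolvent. The form defining `R` is accretive on its graph (`re_inner_nonneg_of_form_limit`), so
the resolvent is unique (`resolvent_unique`), and the graph is `P f = K g` with fixed bounded `P`,
`K` (`exists_isPow_iff`). -/

namespace GradedKG

/-! ### Abstract Hilbert space estimates. -/

section Hilbert

variable {H : Type*} [NormedAddCommGroup H] [InnerProductSpace ℂ H]

/-- Product rule for `⟪v, y⟫` when `v` is differentiable and `y` is continuous and weakly
differentiable in the direction `v t`. -/
theorem hasDerivWithinAt_inner_of_weak {v y : ℝ → H} {v' : H} {d : ℂ} {S : Set ℝ} {t : ℝ}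
    (hv : HasDerivWithinAt v v' S t) (hy : ContinuousWithinAt y S t)
    (hd : HasDerivWithinAt (fun τ => inner ℂ (v t) (y τ)) d S t) :
    HasDerivWithinAt (fun τ => inner ℂ (v τ) (y τ)) (inner ℂ v' (y t) + d) S t := by
  rw [hasDerivWithinAt_iff_tendsto_slope] at hv hd ⊢
  have hy' : Tendsto y (𝓝[S \ {t}] t) (𝓝 (y t)) :=
    hy.tendsto.mono_left (nhdsWithin_mono _ sdiff_subset)
  -- The difference quotient is split so that `y` is differenced only against the fixed vector `v
  -- t`; elsewhere its continuity is enough.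
  refine ((hv.inner hy').add hd).congr fun τ => ?_
  simp only [slope_def_module, inner_sub_left, inner_smul_left_eq_smul, smul_sub]
  abel

/-- A relation which is a compression of a non-negative form on a core is accretive. -/
theorem re_inner_nonneg_of_form_limit {V : Type*} [AddCommGroup V] [Module ℂ V]
    (ι ρ : V →ₗ[ℂ] H)
    (hq : ∀ φ, 0 ≤ (inner ℂ (ι φ) (ρ φ)).re ∧ (inner ℂ (ι φ) (ρ φ)).im = 0)
    {f g : H} (hfg : ∀ φ, inner ℂ (ρ φ) f = inner ℂ (ι φ) g) {φ : ℕ → V}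
    (hφ : Tendsto (fun k => ι (φ k)) atTop (𝓝 f))
    (hc : ∀ δ : ℝ, 0 < δ → ∃ K, ∀ j ≥ K, ∀ k ≥ K,
      (inner ℂ (ι (φ j - φ k)) (ρ (φ j - φ k))).re < δ) :
    0 ≤ (inner ℂ f g).re := by
  have hsymm : ∀ α β, (inner ℂ (ι α) (ρ β)).re = (inner ℂ (ι β) (ρ α)).re := by
    intro α β
    -- Polarisation: once the diagonal terms are known to be real, the imaginary part of the form at
    -- `α + iβ` is the difference of the two sides.
    have h := (hq (α + Complex.I • β)).2
    have hα := (hq α).2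
    have hβ := (hq β).2
    simp only [map_add, map_smul, inner_add_left, inner_add_right, inner_smul_left,
      inner_smul_right, Complex.add_im, Complex.mul_im, Complex.add_re, Complex.mul_re, Complex.conj_I,
      Complex.I_re, Complex.I_im, Complex.neg_re, Complex.neg_im] at h
    linarith
  have hbound : ∀ δ : ℝ, 0 < δ → -δ ≤ (inner ℂ f g).re := by
    intro δ hδ
    obtain ⟨K, hK⟩ := hc δ hδ
    -- Expanding `q(φ j - φ k) < δ` and dropping `q(φ j), q(φ k) ≥ 0` bounds the cross term below.
    -- The limits are then taken one index at a time, `j` first: `ρ (φ k)` need not converge, but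
    -- for fixed `k` the weak identity turns its pairing with `f` into one of `ι (φ k)` with `g`.
    have h1 : ∀ k ≥ K, ∀ j ≥ K, -δ ≤ (inner ℂ (ρ (φ k)) (ι (φ j))).re := by
      intro k hk j hj
      have h := hK j hj k hk
      have hs := hsymm (φ j) (φ k)
      have hj0 := (hq (φ j)).1
      have hk0 := (hq (φ k)).1
      simp only [map_sub, inner_sub_left, inner_sub_right, Complex.sub_re] at h
      have : (inner ℂ (ρ (φ k)) (ι (φ j))).re = (inner ℂ (ι (φ j)) (ρ (φ k))).re :=
        inner_re_symm (𝕜 := ℂ) _ _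
      linarith
    have h2 : ∀ k ≥ K, -δ ≤ (inner ℂ (ι (φ k)) g).re := by
      intro k hk
      rw [← hfg]
      refine ge_of_tendsto (Complex.continuous_re.continuousAt.tendsto.comp
        ((tendsto_const_nhds (x := ρ (φ k))).inner hφ)) ?_
      filter_upwards [eventually_ge_atTop K] with j hj using h1 k hk j hj
    refine ge_of_tendsto (Complex.continuous_re.continuousAt.tendsto.comp
      (hφ.inner (tendsto_const_nhds (x := g)))) ?_
    filter_upwards [eventually_ge_atTop K] with k hk using h2 k hk
  by_contra! hneg
  have := hbound (-(inner ℂ f g).re / 2) (by linarith)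
  linarith

/-- The resolvent `(1 + A)⁻¹` of an accretive linear relation is unique. -/
theorem resolvent_unique {A : H → H → Prop}
    (hsub : ∀ f g f' g', A f g → A f' g' → A (f - f') (g - g'))
    (hacc : ∀ f g, A f g → 0 ≤ (inner ℂ f g).re) {J J' : H →L[ℂ] H}
    (hJ : ∀ h, A (J h) (h - J h)) (hJ' : ∀ h, A (J' h) (h - J' h)) : J = J' := by
  ext h
  have h1 := hacc _ _ (hsub _ _ _ _ (hJ h) (hJ' h))
  -- The difference `d = J h - J' h` is related to `-d`, so accretivity reads `-‖d‖² ≥ 0`.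
  have h2 : h - J h - (h - J' h) = -(J h - J' h) := by abel
  rw [h2, inner_neg_right, Complex.neg_re] at h1
  have h3 : (inner ℂ (J h - J' h) (J h - J' h)).re = ‖J h - J' h‖ ^ 2 :=
    inner_self_eq_norm_sq (𝕜 := ℂ) _
  have h4 : ‖J h - J' h‖ ^ 2 = 0 := le_antisymm (by linarith) (sq_nonneg _)
  exact sub_eq_zero.1 (norm_eq_zero.1 (pow_eq_zero_iff two_ne_zero |>.1 h4))

theorem le_add_of_sq_le_sq_add_mul {S a b : ℝ} (ha : 0 ≤ a) (hb : 0 ≤ b)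
    (h : S ^ 2 ≤ a ^ 2 + b * S) : S ≤ a + b := by
  by_contra! hlt
  nlinarith [mul_nonneg ha hb]

variable [CompleteSpace H]

/-- `L²` bound for weak solutions of `z'' + A* A z + M z = F`, where `M ≥ 0` is bounded and `A` is
the relation `P w = K (A w)`. The equation is tested with `v t = ∫_t^σ z`. -/
theorem norm_le_of_weak_wave_equation (P K M : H →L[ℂ] H)
    (hM : ∀ x y, inner ℂ (M x) y = inner ℂ x (M y)) (hM0 : ∀ x, 0 ≤ (inner ℂ x (M x)).re)
    {T : ℝ} (hT : 0 ≤ T) {z z' Az F : ℝ → H} {c : ℝ}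
    (hz : ContinuousOn z (Icc 0 T)) (hA : ∀ t ∈ Icc 0 T, P (z t) = K (Az t))
    (hAz : ContinuousOn Az (Icc 0 T))
    (hd : ∀ t ∈ Icc 0 T, HasDerivWithinAt z (z' t) (Icc 0 T) t)
    (hz' : ContinuousOn z' (Icc 0 T))
    (heq : ∀ w Aw, P w = K Aw → ∀ t ∈ Icc 0 T,
      HasDerivWithinAt (fun τ => inner ℂ w (z' τ))
        (-(inner ℂ Aw (Az t) + inner ℂ w (M (z t))) + inner ℂ w (F t)) (Icc 0 T) t)
    (hF : ∀ t ∈ Icc 0 T, ‖F t‖ ≤ c) :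
    ∀ t ∈ Icc 0 T, ‖z t‖ ≤ ‖z 0‖ + 2 * T * (‖z' 0‖ + T * c) := by
  have h0 : (0 : ℝ) ∈ Icc 0 T := ⟨le_rfl, hT⟩
  have hc : 0 ≤ c := (norm_nonneg _).trans (hF 0 h0)
  -- With `σ` a maximum point, the same `S` controls `v` and is the quantity recovered at the
  -- endpoint.
  obtain ⟨σ, hσ, hmax⟩ := isCompact_Icc.exists_isMaxOn ⟨0, h0⟩ hz.norm
  set S := ‖z σ‖ with hSdef
  have hS : ∀ t ∈ Icc 0 T, ‖z t‖ ≤ S := fun t ht => hmax ht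
  have hS0 : 0 ≤ S := norm_nonneg _
  intro t ht
  refine (hS t ht).trans ?_
  -- Continuous extensions, constant beyond the endpoints, make the primitives below differentiable
  -- on the whole line.
  let Z : ℝ → H := IccExtend hT ((Icc 0 T).domRestrict z)
  let Y : ℝ → H := IccExtend hT ((Icc 0 T).domRestrict Az)
  have hZc : Continuous Z := hz.domRestrict.Icc_extend'
  have hYc : Continuous Y := hAz.domRestrict.Icc_extend'
  have hZ : ∀ t ∈ Icc 0 T, Z t = z t := fun t ht => IccExtend_of_mem hT _ ht
  have hY : ∀ t ∈ Icc 0 T, Y t = Az t := fun t ht => IccExtend_of_mem hT _ ht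
  have hPK : ∀ t, P (Z t) = K (Y t) := fun t => hA _ (projIcc 0 T hT t).2
  have hZS : ∀ t, ‖Z t‖ ≤ S := fun t => hS _ (projIcc 0 T hT t).2
  let v : ℝ → H := fun t => ∫ τ in t..σ, Z τ
  let Av : ℝ → H := fun t => ∫ τ in t..σ, Y τ
  have hv : ∀ t, HasDerivAt v (-Z t) t := fun t =>
    intervalIntegral.integral_hasDerivAt_left (hZc.intervalIntegrable _ _)
      hZc.aestronglyMeasurable.stronglyMeasurableAtFilter hZc.continuousAt
  have hAv : ∀ t, HasDerivAt Av (-Y t) t := fun t =>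
    intervalIntegral.integral_hasDerivAt_left (hYc.intervalIntegrable _ _)
      hYc.aestronglyMeasurable.stronglyMeasurableAtFilter hYc.continuousAt
  -- Bounded operators commute with the integral, so `v t` is an admissible test vector.
  have hvA : ∀ t, P (v t) = K (Av t) := fun t => by
    simp only [v, Av]
    rw [← ContinuousLinearMap.intervalIntegral_comp_comm _ (hZc.intervalIntegrable _ _),
      ← ContinuousLinearMap.intervalIntegral_comp_comm _ (hYc.intervalIntegrable _ _)]
    simp only [hPK]
  have hvn : ∀ t ∈ Icc 0 σ, ‖v t‖ ≤ S * T := fun t ht => by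
    refine (intervalIntegral.norm_integral_le_of_norm_le_const fun τ _ => hZS τ).trans ?_
    refine mul_le_mul_of_nonneg_left ?_ hS0
    rw [abs_of_nonneg (by linarith [ht.2])]
    linarith [ht.1, hσ.2]
  -- Since `v' = -z` and `Av' = -Az`, the quadratic terms cancel everything in the real part of the
  -- derivative of `⟪v, z'⟫` except the forcing `⟪v, F⟫`.
  let Φ : ℝ → ℂ := fun t => inner ℂ (v t) (z' t) + (1 / 2) * inner ℂ (z t) (z t)
    - (1 / 2) * inner ℂ (Av t) (Av t) - (1 / 2) * inner ℂ (v t) (M (v t))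
  have hΦ : ∀ t ∈ Icc 0 σ, HasDerivWithinAt (fun τ => (Φ τ).re) (inner ℂ (v t) (F t)).re
      (Icc 0 σ) t := by
    intro t ht
    have hsub : Icc 0 σ ⊆ Icc 0 T := Icc_subset_Icc_right hσ.2
    have htT := hsub ht
    have e1 := hasDerivWithinAt_inner_of_weak (hv t).hasDerivWithinAt
      ((hz' t htT).mono hsub) ((heq _ _ (hvA t) t htT).mono hsub)
    have e2 := (((hd t htT).mono hsub).inner ℂ ((hd t htT).mono hsub)).const_mul (1 / 2 : ℂ)
    have e3 := (((hAv t).hasDerivWithinAt (s := Icc 0 σ)).inner ℂ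
      ((hAv t).hasDerivWithinAt)).const_mul (1 / 2 : ℂ)
    have hMv : HasDerivWithinAt (fun τ => M (v τ)) (M (-Z t)) (Icc 0 σ) t :=
      ((M.restrictScalars ℝ).hasFDerivAt.comp_hasDerivAt t (hv t)).hasDerivWithinAt
    have e4 := (((hv t).hasDerivWithinAt (s := Icc 0 σ)).inner ℂ hMv).const_mul (1 / 2 : ℂ)
    have e := (((e1.add e2).sub e3).sub e4)
    have er := Complex.reCLM.hasFDerivAt.comp_hasDerivWithinAt t e
    refine er.congr_deriv ?_
    have s1 : (inner ℂ (z t) (z' t)).re = (inner ℂ (z' t) (z t)).re :=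
      inner_re_symm (𝕜 := ℂ) _ _
    have s2 : (inner ℂ (Av t) (Az t)).re = (inner ℂ (Az t) (Av t)).re :=
      inner_re_symm (𝕜 := ℂ) _ _
    have s3 : (inner ℂ (z t) (M (v t))).re = (inner ℂ (v t) (M (z t))).re := by
      rw [← hM]; exact inner_re_symm (𝕜 := ℂ) _ _
    have hhalf : ∀ w : ℂ, ((1 / 2 : ℂ) * w).re = w.re / 2 := fun w => by
      rw [show (1 / 2 : ℂ) = ((1 / 2 : ℝ) : ℂ) by push_cast; rfl, Complex.re_ofReal_mul]; ring
    simp only [Complex.reCLM_apply, Complex.sub_re, Complex.add_re, hhalf, Complex.neg_re,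
      inner_neg_left, inner_neg_right, map_neg, hZ t htT, hY t htT]
    linarith
  have hΦb : ∀ t ∈ Ico 0 σ, ‖(inner ℂ (v t) (F t)).re‖ ≤ S * T * c := fun t ht => by
    refine (Complex.abs_re_le_norm _).trans ((norm_inner_le_norm _ _).trans ?_)
    exact mul_le_mul (hvn t ⟨ht.1, ht.2.le⟩) (hF t ⟨ht.1, ht.2.le.trans hσ.2⟩)
      (norm_nonneg _) (by positivity)
  have hdiff := norm_image_sub_le_of_norm_deriv_le_segment' hΦ hΦb σ ⟨hσ.1, le_rfl⟩
  rw [Real.norm_eq_abs, sub_zero] at hdiff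
  have hself : ∀ x : H, (inner ℂ x x).re = ‖x‖ ^ 2 := fun x => inner_self_eq_norm_sq (𝕜 := ℂ) x
  have hhalf : ∀ w : ℂ, ((1 / 2 : ℂ) * w).re = w.re / 2 := fun w => by
    rw [show (1 / 2 : ℂ) = ((1 / 2 : ℝ) : ℂ) by push_cast; rfl, Complex.re_ofReal_mul]; ring
  have hΦσ : (Φ σ).re = S ^ 2 / 2 := by
    have h1 : v σ = 0 := intervalIntegral.integral_same
    have h2 : Av σ = 0 := intervalIntegral.integral_same
    simp only [Φ, h1, h2, inner_zero_left, Complex.sub_re, Complex.add_re, hhalf, hself,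
      Complex.zero_re]
    ring
  have hΦ0 : (Φ 0).re ≤ S * T * ‖z' 0‖ + ‖z 0‖ ^ 2 / 2 := by
    have h1 : (inner ℂ (v 0) (z' 0)).re ≤ S * T * ‖z' 0‖ :=
      (Complex.re_le_norm _).trans ((norm_inner_le_norm _ _).trans
        (mul_le_mul_of_nonneg_right (hvn 0 ⟨le_rfl, hσ.1⟩) (norm_nonneg _)))
    have h2 := hM0 (v 0)
    have h3 := sq_nonneg ‖Av 0‖
    simp only [Φ, Complex.sub_re, Complex.add_re, hhalf, hself]
    linarith
  have h5 : S * T * c * σ ≤ S * T * c * T := mul_le_mul_of_nonneg_left hσ.2 (by positivity)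
  have h6 := le_abs_self ((Φ σ).re - (Φ 0).re)
  -- Comparing `Φ` at `0` and `σ` gives `S² ≤ ‖z 0‖² + 2T(‖z' 0‖ + T c) S`, from which one factor
  -- `S` is absorbed.
  refine le_add_of_sq_le_sq_add_mul (norm_nonneg _) (by positivity) ?_
  nlinarith

end Hilbert

end GradedKG

/-! ### Realisation of the operators on `L²`. -/

noncomputable section
namespace GradedKG

theorem inner_L2_eq_integral {n : ℕ} (f g : L2 n) {f' g' : Pt n → ℂ} (hf : f =ᵐ[volume] f')
    (hg : g =ᵐ[volume] g') : inner ℂ f g = ∫ x, conj (f' x) * g' x := by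
  rw [L2.inner_def]
  refine integral_congr_ae ?_
  filter_upwards [hf, hg] with x h1 h2
  rw [RCLike.inner_apply, h1, h2, mul_comm]

/-- Multiplication by an essentially bounded function as a bounded operator on `L²`. -/
theorem exists_mulOperator {n : ℕ} {m : Pt n → ℝ} (hm : MemLp m ∞ volume) :
    ∃ M : L2 n →L[ℂ] L2 n, (∀ f, M f =ᵐ[volume] fun x => (m x : ℂ) * f x) ∧
      ∀ f, ‖M f‖ ≤ (eLpNorm m ∞ volume).toReal * ‖f‖ := by
  have hm' : MemLp (fun x => (m x : ℂ)) ∞ volume := hm.ofReal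
  refine ⟨(ContinuousLinearMap.lsmul ℂ ℂ).holderL volume ∞ 2 2 hm'.toLp, fun f => ?_, fun f => ?_⟩
  · refine ((ContinuousLinearMap.lsmul ℂ ℂ).coeFn_holder hm'.toLp f).trans ?_
    filter_upwards [hm'.coeFn_toLp] with x hx
    simp [hx]
  · have h : (ContinuousLinearMap.lsmul ℂ ℂ).holderL volume ∞ 2 2 hm'.toLp f
        = hm'.toLp • f := by
      refine Lp.ext (((ContinuousLinearMap.lsmul ℂ ℂ).coeFn_holder hm'.toLp f).trans ?_)
      filter_upwards [Lp.coeFn_lpSMul (r := 2) hm'.toLp f] with x hx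
      simp [hx]
    rw [h]
    refine (Lp.norm_smul_le _ _).trans_eq ?_
    rw [Lp.norm_toLp, eLpNorm_congr_norm_ae (g := m) (ae_of_all _ fun x => by simp)]

namespace GradedGroup

variable {n : ℕ} (G : GradedGroup n)

theorem differentiableAt_comp_mul {f : Pt n → ℂ} (hf : ContDiff ℝ ∞ f) (x y : Pt n) :
    DifferentiableAt ℝ (fun y => f (G.mul x y)) y :=
  ((hf.comp G.contDiff_mul).comp (contDiff_prodMk_right x)).differentiable (by simp) y

theorem wordField_add (w : List (Fin n)) {f g : Pt n → ℂ} (hf : ContDiff ℝ ∞ f)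
    (hg : ContDiff ℝ ∞ g) : G.wordField w (f + g) = G.wordField w f + G.wordField w g := by
  induction w with
  | nil => rfl
  | cons j w ih =>
    change G.leftField j (G.wordField w (f + g))
      = G.leftField j (G.wordField w f) + G.leftField j (G.wordField w g)
    rw [ih]
    ext x
    simp only [leftField, Pi.add_apply]
    rw [fderiv_fun_add (G.differentiableAt_comp_mul (G.contDiff_wordField w hf) x 0)
      (G.differentiableAt_comp_mul (G.contDiff_wordField w hg) x 0)]
    rfl

theorem wordField_smul (w : List (Fin n)) (a : ℂ) {f : Pt n → ℂ} (hf : ContDiff ℝ ∞ f) :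
    G.wordField w (a • f) = a • G.wordField w f := by
  induction w with
  | nil => rfl
  | cons j w ih =>
    change G.leftField j (G.wordField w (a • f)) = a • G.leftField j (G.wordField w f)
    rw [ih]
    ext x
    simp only [leftField, Pi.smul_apply]
    rw [fderiv_fun_const_smul (G.differentiableAt_comp_mul (G.contDiff_wordField w hf) x 0)]
    rfl

theorem diffOp_add (c : List (Fin n) →₀ ℂ) {f g : Pt n → ℂ} (hf : ContDiff ℝ ∞ f)
    (hg : ContDiff ℝ ∞ g) : G.diffOp c (f + g) = G.diffOp c f + G.diffOp c g := by
  ext x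
  simp only [diffOp, Pi.add_apply, Finsupp.sum, ← Finset.sum_add_distrib, G.wordField_add _ hf hg,
    mul_add]

theorem diffOp_smul (c : List (Fin n) →₀ ℂ) (a : ℂ) {f : Pt n → ℂ} (hf : ContDiff ℝ ∞ f) :
    G.diffOp c (a • f) = a • G.diffOp c f := by
  ext x
  simp only [diffOp, Pi.smul_apply, Finsupp.sum, G.wordField_smul _ a hf, smul_eq_mul,
    Finset.mul_sum, mul_left_comm]

theorem continuous_diffOp (c : List (Fin n) →₀ ℂ) {f : Pt n → ℂ} (hf : ContDiff ℝ ∞ f) :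
    Continuous (G.diffOp c f) := by
  unfold diffOp Finsupp.sum
  exact continuous_finsetSum _ fun w _ =>
    continuous_const.mul (G.contDiff_wordField _ hf).continuous

theorem hasCompactSupport_diffOp (c : List (Fin n) →₀ ℂ) {f : Pt n → ℂ}
    (hf : HasCompactSupport f) : HasCompactSupport (G.diffOp c f) := by
  refine HasCompactSupport.intro hf.isCompact fun x hx => Finset.sum_eq_zero fun w _ => ?_
  have : x ∉ tsupport (G.wordField w f) := fun h => hx (G.tsupport_wordField_subset _ _ h)
  simp [image_eq_zero_of_notMem_tsupport this]

end GradedGroup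

theorem memLp_test {n : ℕ} (φ : Test n) : MemLp φ 2 (volume : Measure (Pt n)) :=
  φ.continuous.memLp_of_hasCompactSupport φ.hasCompactSupport

/-- The inclusion of the test functions into `L²`. -/
def testToL2 (n : ℕ) : Test n →ₗ[ℂ] L2 n where
  toFun φ := (memLp_test φ).toLp φ
  map_add' _ _ := rfl
  map_smul' _ _ := rfl

theorem coeFn_testToL2 {n : ℕ} (φ : Test n) : testToL2 n φ =ᵐ[volume] φ :=
  (memLp_test φ).coeFn_toLp

namespace GradedGroup

variable {n : ℕ} (G : GradedGroup n)

theorem memLp_diffOp (c : List (Fin n) →₀ ℂ) (φ : Test n) :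
    MemLp (G.diffOp c φ) 2 (volume : Measure (Pt n)) :=
  (G.continuous_diffOp c φ.contDiff).memLp_of_hasCompactSupport
    (G.hasCompactSupport_diffOp c φ.hasCompactSupport)

/-- A left-invariant differential operator as a linear map from test functions to `L²`. -/
def diffOpL2 (c : List (Fin n) →₀ ℂ) : Test n →ₗ[ℂ] L2 n where
  toFun φ := (G.memLp_diffOp c φ).toLp _
  map_add' φ ψ := by
    rw [← MemLp.toLp_add]
    exact MemLp.toLp_congr _ _ (ae_of_all _ fun x =>
      congrFun (G.diffOp_add c φ.contDiff ψ.contDiff) x)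
  map_smul' a φ := by
    rw [RingHom.id_apply, ← MemLp.toLp_const_smul]
    exact MemLp.toLp_congr _ _ (ae_of_all _ fun x => congrFun (G.diffOp_smul c a φ.contDiff) x)

theorem coeFn_diffOpL2 (c : List (Fin n) →₀ ℂ) (φ : Test n) :
    G.diffOpL2 c φ =ᵐ[volume] G.diffOp c φ :=
  (G.memLp_diffOp c φ).coeFn_toLp

theorem quadForm_eq_inner (c : List (Fin n) →₀ ℂ) (φ : Test n) :
    G.quadForm c φ = inner ℂ (testToL2 n φ) (G.diffOpL2 c φ) := by
  rw [inner_L2_eq_integral _ _ (coeFn_testToL2 φ) (G.coeFn_diffOpL2 c φ)]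
  simp only [quadForm, mul_comm]

/-! ### The graph of the Rockland operator and bounds for solutions. -/

namespace PositiveRockland

variable {G} {ν : ℝ} (R : G.PositiveRockland ν)

/-- Puts the integral definition into inner products of two linear maps on test functions, the form
required by the abstract accretivity lemma. -/
theorem isOp_iff (f g : L2 n) : R.IsOp f g ↔
    (∀ φ, inner ℂ (G.diffOpL2 R.coeff φ) f = inner ℂ (testToL2 n φ) g) ∧
    ∃ φ : ℕ → Test n, Tendsto (fun k => testToL2 n (φ k)) atTop (𝓝 f) ∧
      ∀ δ : ℝ, 0 < δ → ∃ K, ∀ j ≥ K, ∀ k ≥ K,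
        (inner ℂ (testToL2 n (φ j - φ k)) (G.diffOpL2 R.coeff (φ j - φ k))).re < δ := by
  have h1 : ∀ φ, inner ℂ (G.diffOpL2 R.coeff φ) f
      = ∫ x, f x * conj (G.diffOp R.coeff φ x) := fun φ => by
    rw [inner_L2_eq_integral _ _ (G.coeFn_diffOpL2 R.coeff φ) (ae_eq_refl _)]
    simp only [mul_comm]
  have h2 : ∀ φ, inner ℂ (testToL2 n φ) g = ∫ x, g x * conj (φ x) := fun φ => by
    rw [inner_L2_eq_integral _ _ (coeFn_testToL2 φ) (ae_eq_refl _)]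
    simp only [mul_comm]
  have h3 : ∀ φ : ℕ → Test n, Tendsto (fun k => testToL2 n (φ k)) atTop (𝓝 f) ↔
      Tendsto (fun k => eLpNorm (fun x => φ k x - f x) 2 volume) atTop (𝓝 0) := fun φ => by
    rw [Lp.tendsto_Lp_iff_tendsto_eLpNorm']
    refine tendsto_congr fun k => eLpNorm_congr_ae ?_
    filter_upwards [coeFn_testToL2 (φ k)] with x hx
    simp [hx]
  simp only [IsOp, h1, h2, h3, quadForm_eq_inner]

theorem isOp_accretive {f g : L2 n} (h : R.IsOp f g) : 0 ≤ (inner ℂ f g).re := by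
  obtain ⟨h1, φ, h2, h3⟩ := (R.isOp_iff f g).1 h
  refine re_inner_nonneg_of_form_limit (testToL2 n) (G.diffOpL2 R.coeff) (fun φ => ?_) h1 h2 h3
  rw [← quadForm_eq_inner]
  exact R.nonneg φ

theorem isOp_sub {f g f' g' : L2 n} (h : R.IsOp f g) (h' : R.IsOp f' g') :
    R.IsOp (f - f') (g - g') := by
  rw [isOp_iff] at h h' ⊢
  obtain ⟨h1, φ, h2, h3⟩ := h
  obtain ⟨h1', φ', h2', h3'⟩ := h'
  refine ⟨fun φ => by rw [inner_sub_right, inner_sub_right, h1, h1'], fun k => φ k - φ' k, ?_, ?_⟩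
  · simpa only [map_sub] using h2.sub h2'
  · intro δ hδ
    -- Parallelogram law: `q(α - β) = 2 q(α) + 2 q(β) - q(α + β)` with `q(α + β) ≥ 0`, whence the
    -- quarter of `δ`.
    obtain ⟨K, hK⟩ := h3 (δ / 4) (by linarith)
    obtain ⟨K', hK'⟩ := h3' (δ / 4) (by linarith)
    refine ⟨max K K', fun j hj k hk => ?_⟩
    have e1 := hK j (le_of_max_le_left hj) k (le_of_max_le_left hk)
    have e2 := hK' j (le_of_max_le_right hj) k (le_of_max_le_right hk)
    rw [show φ j - φ' j - (φ k - φ' k) = (φ j - φ k) - (φ' j - φ' k) by abel]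
    generalize φ j - φ k = α at *
    generalize φ' j - φ' k = β at *
    have e3 := (R.nonneg (α + β)).1
    rw [quadForm_eq_inner] at e3
    simp only [map_add, map_sub, inner_add_left, inner_add_right, inner_sub_left, inner_sub_right,
      Complex.add_re, Complex.sub_re] at e3 ⊢
    linarith

/-- All instances of the relation `R₂ ^ a f = g` are computed with the same pair of bounded
operators. -/
theorem exists_isPow_iff {a : ℝ} {f₀ g₀ : L2 n} (h₀ : R.IsPow a f₀ g₀) :
    ∃ P K : L2 n →L[ℂ] L2 n, ∀ f g, R.IsPow a f g ↔ P f = K g := by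
  obtain ⟨J, hJ, -⟩ := h₀
  -- Unification takes `P` and `K` to be the two functional calculus operators of `J`; the converse
  -- replaces any other resolvent by `J`.
  refine ⟨_, _, fun f g => ⟨?_, fun h => ⟨J, hJ, h⟩⟩⟩
  rintro ⟨J', hJ', h⟩
  rwa [resolvent_unique (fun _ _ _ _ => R.isOp_sub) (fun _ _ => R.isOp_accretive) hJ' hJ] at h

/-- `L²` bound for the difference of two solutions with different masses and data. -/
theorem norm_sub_le {s T : ℝ} (hT : 0 < T) {m m' : Pt n → ℝ} (hm0 : 0 ≤ᵐ[volume] m)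
    (hm : MemLp m ∞ volume) (hm' : MemLp m' ∞ volume) {f₀ f₁ f₀' f₁' : L2 n} {u u' : ℝ → L2 n}
    (hu : R.IsSolution s T m f₀ f₁ u) (hu' : R.IsSolution s T m' f₀' f₁' u') {B : ℝ}
    (hB : ∀ t ∈ Icc 0 T, ‖u' t‖ ≤ B) :
    ∀ t ∈ Icc 0 T, ‖u t - u' t‖ ≤ ‖f₀ - f₀'‖ + 2 * T * (‖f₁ - f₁'‖ +
      T * ((eLpNorm (fun x => m x - m' x) ∞ volume).toReal * B)) := by
  obtain ⟨y, Au, hu1, hu2, hu3, hu4, hu5, hu6, hu7, hu8⟩ := hu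
  obtain ⟨y', Au', hv1, hv2, hv3, hv4, hv5, hv6, hv7, hv8⟩ := hu'
  have h0 : (0 : ℝ) ∈ Icc 0 T := ⟨le_rfl, hT.le⟩
  obtain ⟨P, K, hPK⟩ := R.exists_isPow_iff (hu2 0 h0)
  simp only [hPK] at hu2 hu8 hv2 hv8
  obtain ⟨M, hM, -⟩ := exists_mulOperator hm
  obtain ⟨D, hD, hDn⟩ := exists_mulOperator (hm.sub hm')
  obtain ⟨M', hM', -⟩ := exists_mulOperator hm'
  have hMD : ∀ f, D f = M f - M' f := fun f => by
    refine Lp.ext ?_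
    filter_upwards [hM f, hM' f, hD f, Lp.coeFn_sub (M f) (M' f)] with x h1 h2 h3 h4
    rw [h3, h4, Pi.sub_apply, Pi.sub_apply, h1, h2]
    simp [sub_mul]
  have hMi : ∀ f g, inner ℂ f (M g) = ∫ x, conj (f x) * ((m x : ℂ) * g x) := fun f g =>
    inner_L2_eq_integral _ _ (ae_eq_refl _) (hM g)
  have hMi' : ∀ f g, inner ℂ f (M' g) = ∫ x, conj (f x) * ((m' x : ℂ) * g x) := fun f g =>
    inner_L2_eq_integral _ _ (ae_eq_refl _) (hM' g)
  have hsymm : ∀ f g, inner ℂ (M f) g = inner ℂ f (M g) := fun f g => by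
    rw [hMi, inner_L2_eq_integral _ _ (hM f) (ae_eq_refl _)]
    refine integral_congr_ae (ae_of_all _ fun x => ?_)
    simp only [map_mul, Complex.conj_ofReal]
    ring
  have hpos : ∀ f, 0 ≤ (inner ℂ f (M f)).re := fun f => by
    have : inner ℂ f (M f) = ((∫ x, m x * ‖f x‖ ^ 2 : ℝ) : ℂ) := by
      rw [hMi, ← integral_complex_ofReal]
      refine integral_congr_ae (ae_of_all _ fun x => ?_)
      simp only [Complex.ofReal_mul, Complex.ofReal_pow, ← Complex.conj_mul']
      ring
    rw [this, Complex.ofReal_re]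
    refine integral_nonneg_of_ae ?_
    filter_upwards [hm0] with x hx
    exact mul_nonneg hx (sq_nonneg _)
  -- The splitting `m u - m' u' = m (u - u') + (m - m') u'` leaves the second term as forcing, so
  -- only `m` has to be non-negative.
  have key := norm_le_of_weak_wave_equation P K M hsymm hpos hT.le (z := fun t => u t - u' t)
    (z' := fun t => y t - y' t) (Az := fun t => Au t - Au' t) (F := fun t => -D (u' t))
    (c := (eLpNorm (fun x => m x - m' x) ∞ volume).toReal * B) (hu1.sub hv1)
    (fun t ht => by rw [map_sub, map_sub, hu2 t ht, hv2 t ht]) (hu3.sub hv3)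
    (fun t ht => (hu4 t ht).sub (hv4 t ht)) (hu5.sub hv5) ?_ ?_
  · simpa only [hu6, hu7, hv6, hv7] using key
  · intro w Aw hw t ht
    have h := (hu8 w Aw hw t ht).sub (hv8 w Aw hw t ht)
    rw [← hMi, ← hMi'] at h
    simp only [inner_sub_right]
    refine h.congr_deriv ?_
    rw [hMD]
    simp only [map_sub, inner_sub_right, inner_neg_right]
    ring
  · intro t ht
    rw [norm_neg]
    exact (hDn _).trans (mul_le_mul_of_nonneg_left (hB t ht) ENNReal.toReal_nonneg)

/-- Even the pair `(0, 0)` belongs to the graph of the power only if a resolvent exists; the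
instance `h` provides one. -/
theorem isSolution_zero {s T : ℝ} (m : Pt n → ℝ) {g₀ h₀ : L2 n}
    (h : R.IsPow (s * ν / 2 / ν) g₀ h₀) : R.IsSolution s T m 0 0 (fun _ => 0) := by
  obtain ⟨P, K, hPK⟩ := R.exists_isPow_iff h
  have hint : ∀ w : L2 n, ∫ x, conj (w x) * ((m x : ℂ) * (0 : L2 n) x) = 0 := fun w => by
    simp
  refine ⟨fun _ => 0, fun _ => 0, continuousOn_const, fun t _ => (hPK 0 0).2 (by simp),
    continuousOn_const, fun t _ => hasDerivWithinAt_const _ _ _, continuousOn_const, rfl, rfl, ?_⟩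
  intro w Aw _ t _
  simpa only [hint, inner_zero_right, add_zero, neg_zero] using
    hasDerivWithinAt_const t (Icc 0 T) (0 : ℂ)

/-- Comparison with the zero solution for the same mass: the forcing vanishes, so no bound on the
size of `m` enters. -/
theorem norm_solution_le {s T : ℝ} (hT : 0 < T) {m : Pt n → ℝ} (hm0 : 0 ≤ᵐ[volume] m)
    (hm : MemLp m ∞ volume) {f₀ f₁ : L2 n} {u : ℝ → L2 n} (hu : R.IsSolution s T m f₀ f₁ u) :
    ∀ t ∈ Icc 0 T, ‖u t‖ ≤ ‖f₀‖ + 2 * T * ‖f₁‖ := by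
  have hz : R.IsSolution s T m 0 0 (fun _ => 0) := by
    obtain ⟨y, Au, -, h, -⟩ := hu
    exact R.isSolution_zero m (h 0 ⟨le_rfl, hT.le⟩)
  simpa using R.norm_sub_le hT hm0 hm hm hu hz (B := 0) (by simp)

end PositiveRockland
end GradedGroup
end GradedKG

end

/-! ### From the `L²` bound to negligible nets. -/

theorem mainTheorem2 {n : ℕ} (G : GradedKG.GradedGroup n) {ν : ℝ} (R : G.PositiveRockland ν)
    (s T : ℝ) (hs : 0 < s) (hT : 0 < T)
    (u₀ u₁ : GradedKG.Distr (⊤ : Opens (GradedKG.Pt n)))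
    (hu₀ : (∃ h, R.MemSobolev (s * ν / 2) h ∧ GradedKG.IsFunction u₀ h) ∨
      GradedKG.HasCompactSupp u₀)
    (hu₁ : (∃ h, GradedKG.IsFunction u₁ h) ∨ GradedKG.HasCompactSupp u₁) :
    GradedKG.IsLInftyUnique R s T u₀ u₁ := by
  intro m m' hm0 hm'0 hm hm' hmm f₀ f₁ f₀' f₁' _ _ _ _ _ hf₀' _ hf₁' hd₀ hd₁ u u' hu hu' N
  obtain ⟨Na, Ca, ha⟩ := hf₀'
  obtain ⟨Nb, Cb, hb⟩ := hf₁'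
  obtain ⟨_, _, hmLp⟩ := hm
  obtain ⟨_, _, hmLp'⟩ := hm'
  obtain ⟨C₀, h₀⟩ := hd₀ N
  obtain ⟨C₁, h₁⟩ := hd₁ N
  -- The extra `Na + Nb` powers offset the growth `ε^{-(Na + Nb)}` of the second solution in the
  -- forcing term.
  obtain ⟨C₂, h₂⟩ := hmm (N + (Na + Nb))
  have hone : (1 : ℝ) ∈ Ioc (0 : ℝ) 1 := ⟨one_pos, le_rfl⟩
  have ha' : ∀ ε ∈ Ioc (0 : ℝ) 1, ‖f₀' ε‖ ≤ Ca * (ε ^ Na)⁻¹ := fun ε hε => by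
    obtain ⟨g, -, hg⟩ := ha ε hε
    linarith [norm_nonneg g]
  have h₀' : ∀ ε ∈ Ioc (0 : ℝ) 1, ‖f₀ ε - f₀' ε‖ ≤ C₀ * ε ^ N := fun ε hε => by
    obtain ⟨g, -, hg⟩ := h₀ ε hε
    linarith [norm_nonneg g]
  have hCa : 0 ≤ Ca := by simpa using (norm_nonneg _).trans (ha' 1 hone)
  -- Moderateness does not prescribe the sign of its constants; evaluation at `ε = 1` does.
  have hCb : 0 ≤ Cb := by simpa using (norm_nonneg _).trans (hb 1 hone)
  refine ⟨C₀ + 2 * T * (C₁ + T * (C₂ * (Ca + 2 * T * Cb))), fun ε hε t ht => ?_⟩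
  have hε0 : 0 < ε := hε.1
  have hinv : ∀ k l : ℕ, (ε ^ k)⁻¹ ≤ (ε ^ (k + l))⁻¹ := fun k l =>
    inv_anti₀ (by positivity) (pow_le_pow_of_le_one hε0.le hε.2 (Nat.le_add_right k l))
  have hB : ∀ t ∈ Icc 0 T, ‖u' ε t‖ ≤ (Ca + 2 * T * Cb) * (ε ^ (Na + Nb))⁻¹ := fun t ht => by
    have e := R.norm_solution_le hT (hm'0 ε hε) (hmLp' ε hε).1 (hu' ε hε) t ht
    have e1 : ‖f₀' ε‖ ≤ Ca * (ε ^ (Na + Nb))⁻¹ :=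
      (ha' ε hε).trans (mul_le_mul_of_nonneg_left (hinv Na Nb) hCa)
    have e2 : ‖f₁' ε‖ ≤ Cb * (ε ^ (Na + Nb))⁻¹ :=
      (hb ε hε).trans (mul_le_mul_of_nonneg_left (by rw [add_comm]; exact hinv Nb Na) hCb)
    have e3 := mul_le_mul_of_nonneg_left e2 (by positivity : 0 ≤ 2 * T)
    linarith
  have hB0 : 0 ≤ (Ca + 2 * T * Cb) * (ε ^ (Na + Nb))⁻¹ := by positivity
  refine (R.norm_sub_le hT (hm0 ε hε) (hmLp ε hε).1 (hmLp' ε hε).1 (hu ε hε) (hu' ε hε) hB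
    t ht).trans ?_
  have e1 := h₀' ε hε
  have e2 := h₁ ε hε
  have e3 : (eLpNorm (fun x => m ε x - m' ε x) ∞ volume).toReal
      * ((Ca + 2 * T * Cb) * (ε ^ (Na + Nb))⁻¹) ≤ C₂ * (Ca + 2 * T * Cb) * ε ^ N := by
    refine (mul_le_mul_of_nonneg_right (h₂ ε hε).2 hB0).trans_eq ?_
    rw [pow_add]
    field_simp
  calc _ ≤ C₀ * ε ^ N + 2 * T * (C₁ * ε ^ N + T * (C₂ * (Ca + 2 * T * Cb) * ε ^ N)) := by gcongr
    _ = _ := by ring
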